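/- For a sequence $(x_n)_{n\ge 1}$ in $[0,1)$ and $N \ge 1$, place the points $x_1,\dots,x_N$ on the circle $\mathbb{R}/\mathbb{Z}$ of length $1$; the gap lengths at step $N$ are the different arc lengths between neighbouring points (if there is only one point, the only gap length is $1$). A gap system consists of indices $N_0<N_1<\cdots$ and an integer $s$ such that for every $i$ the points $x_1,\dots,x_{N_i}$ have exactly $s$ different gap lengths $L^{(i)}_1<\cdots<L^{(i)}_s$. For real $\alpha$, the $j$-th gap length of the system is called $\alpha$-small if $\lim_{i\to\infty} N_i^\alpha L^{(i)}_j=0$, and $\alpha$-intermediate if there are constants $K_1,K_2>0$ with $K_1/N_i^\alpha\le L^{(i)}_j\le K_2/N_i^\alpha$ for all $i$. Lemma. Let $z\in\mathbb{R}\setminus\mathbb{Q}$ have continued fraction expansion $[a_0;a_1,a_2,\dots]$ with convergents $p_i/q_i$, and let $x_n=\{nz\}$, $n\ge 1$, be its Kronecker sequence. (1) If the sequence $(a_i)$ is bounded, then for every real $\alpha<1$ the Kronecker sequence has only $\alpha$-small gap lengths: for every gap system $(N_i),s,(L^{(i)}_j)$ of $(x_n)$ and every $j\in\{1,\dots,s\}$,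 the $j$-th gap length is $\alpha$-small; moreover, if $\ell_N$ is any gap length of $x_1,\dots,x_N$, for each $N\ge1$, then $\lim_{N\to\infty}N^\alpha \ell_N=0$. (2) Whether or not the $a_i$ are bounded, for every $i_0$ with $q_{i_0}\ge 2$ the indices $N_i=q_{i_0+i}$, $i\ge 0$, form a gap system with exactly $s=2$ gap lengths $L^{(i)}_1<L^{(i)}_2$, and the larger gap length $L^{(i)}_2$ is $1$-intermediate. -/

import Mathlib

open Filter Topology

/-- The set of gap lengths of the points `x 1, …, x N` placed on the circle `ℝ / ℤ` of length one:
the arc lengths from one of the points `x m`, in positive direction, to the next point.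
(If there is only one point on the circle, the only gap has length one.) -/
def gapLengths (x : ℕ → ℝ) (N : ℕ) : Set ℝ :=
  {l | ∃ m ∈ Finset.Icc 1 N,
    IsLeast {t : ℝ | 0 < t ∧ ∃ n ∈ Finset.Icc 1 N, ∃ k : ℤ, x m + t = x n + k} l}

/-- `N 0 < N 1 < …` is a sequence of indices such that, for every `i`, the points
`x 1, …, x (N i)` have exactly `s` different gap lengths, namely
`L i 0 < L i 1 < … < L i (s - 1)`. -/
structure IsGapSystem (x : ℕ → ℝ) (N : ℕ → ℕ) (s : ℕ) (L : ℕ → Fin s → ℝ) : Prop where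
  strictMono_index : StrictMono N
  strictMono_length : ∀ i, StrictMono (L i)
  range_length : ∀ i, Set.range (L i) = gapLengths x (N i)

/-- The gap lengths `l i` (occurring for the first `N i` points) are `α`-small. -/
def IsSmallGap (α : ℝ) (N : ℕ → ℕ) (l : ℕ → ℝ) : Prop :=
  Tendsto (fun i => (N i : ℝ) ^ α * l i) atTop (𝓝 0)

/-- The gap lengths `l i` (occurring for the first `N i` points) are `α`-intermediate. -/
def IsIntermediateGap (α : ℝ) (N : ℕ → ℕ) (l : ℕ → ℝ) : Prop :=
  ∃ K₁ K₂ : ℝ, 0 < K₁ ∧ 0 < K₂ ∧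
    ∀ i, K₁ / (N i : ℝ) ^ α ≤ l i ∧ l i ≤ K₂ / (N i : ℝ) ^ α

/-- The Kronecker sequence `({n z})`. -/
noncomputable def kronecker (z : ℝ) (n : ℕ) : ℝ := Int.fract (n * z)

/-- The partial quotients `a₁, a₂, …` of the continued fraction of `z` are bounded. -/
def HasBoundedPartialQuotients (z : ℝ) : Prop :=
  ∃ K : ℝ, ∀ (n : ℕ) (a : ℝ), (GenContFract.of z).partDens.get? n = some a → a ≤ K

/-- The denominator `qᵢ` of the `i`-th convergent of `z`, as a natural number. -/
noncomputable def convDen (z : ℝ) (i : ℕ) : ℕ := ⌊(GenContFract.of z).dens i⌋₊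

/-- The floor in `convDen` rounds nothing. -/
theorem convDen_cast (z : ℝ) (i : ℕ) : (convDen z i : ℝ) = (GenContFract.of z).dens i := by
  have key : ∀ n : ℕ, (∃ m : ℤ, (GenContFract.of z).dens n = m) ∧
      ∃ m : ℤ, (GenContFract.of z).dens (n + 1) = m := by
    intro n
    induction n with
    | zero =>
      refine ⟨⟨1, by simp⟩, ?_⟩
      by_cases ht : (GenContFract.of z).TerminatedAt 0
      · exact ⟨1, by rw [GenContFract.dens_stable_of_terminated (Nat.le_succ 0) ht]; simp⟩
      · obtain ⟨gp, hgp⟩ := Option.ne_none_iff_exists'.mp ht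
        obtain ⟨-, b, hb⟩ := GenContFract.of_partNum_eq_one_and_exists_int_partDen_eq hgp
        exact ⟨b, by rw [GenContFract.first_den_eq hgp, hb]⟩
    | succ n ih =>
      obtain ⟨⟨c, hc⟩, d, hd⟩ := ih
      refine ⟨⟨d, hd⟩, ?_⟩
      by_cases ht : (GenContFract.of z).TerminatedAt (n + 1)
      · exact ⟨d, by rw [GenContFract.dens_stable_of_terminated (Nat.le_succ (n + 1)) ht, hd]⟩
      · obtain ⟨gp, hgp⟩ := Option.ne_none_iff_exists'.mp ht
        obtain ⟨ha, b, hb⟩ := GenContFract.of_partNum_eq_one_and_exists_int_partDen_eq hgp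
        refine ⟨b * d + c, ?_⟩
        rw [GenContFract.dens_recurrence hgp hc hd, ha, hb]
        push_cast
        ring
  obtain ⟨m, hm⟩ := (key i).1
  have h0 : 0 ≤ (GenContFract.of z).dens i := GenContFract.zero_le_of_den
  rw [convDen, hm]
  rw [hm] at h0
  have h1 : 0 ≤ m := by exact_mod_cast h0
  lift m to ℕ using h1
  simp

/-! Arcs between points of the sequence have the form `(n - m) * z + k`. Let `q`, `r` be consecutive
convergent denominators with errors `a = q z - p`, `b = r z - p'`. The pairs `(q, p)`, `(r, p')`
form a basis of ℤ², so every arc is `u a + v b`; since `a`, `b` have opposite signs and indices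
differ by less than `q`, the gaps of `q` points are exactly `|b|` and `|a| + |b|`
(`gapLengths_eq_pair`). The determinant gives `q |b| + r |a| = 1`; with `r ≤ q` and `|a| < |b|` this
yields `1 ≤ q (|a| + |b|) ≤ 2`, which is (2). For (1), `|a| + |b|` still bounds the gaps of any `N ≥
q` points (`gap_le_add_abs`). Bounded partial quotients keep `N / q` bounded up to the next
denominator, so `N * l` is bounded and `N ^ α * l` tends to zero. -/

open GenContFract

/-- Gap lengths of a Kronecker sequence in terms of differences of indices. -/
theorem mem_gapLengths_kronecker {z : ℝ} {N : ℕ} {l : ℝ} :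
    l ∈ gapLengths (kronecker z) N ↔ ∃ m ∈ Finset.Icc 1 N,
      IsLeast {t : ℝ | 0 < t ∧ ∃ n ∈ Finset.Icc 1 N, ∃ k : ℤ, t = ((n : ℝ) - m) * z + k} l := by
  have key : ∀ (m n : ℕ) (t : ℝ), (∃ k : ℤ, kronecker z m + t = kronecker z n + k) ↔
      ∃ k : ℤ, t = ((n : ℝ) - m) * z + k := by
    intro m n t
    simp only [kronecker, Int.fract]
    constructor
    · rintro ⟨k, hk⟩
      exact ⟨⌊m * z⌋ - ⌊n * z⌋ + k, by push_cast; linarith⟩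
    · rintro ⟨k, hk⟩
      exact ⟨k - ⌊m * z⌋ + ⌊n * z⌋, by push_cast; linarith⟩
  simp only [gapLengths, Set.mem_ofPred_eq, key]

/-- Reversing the indices by `n ↦ N + 1 - n` negates all index differences. This later allows
assuming `a < 0 < b`. -/
theorem gapLengths_kronecker_neg_subset (z : ℝ) (N : ℕ) :
    gapLengths (kronecker z) N ⊆ gapLengths (kronecker (-z)) N := by
  intro l hl
  rw [mem_gapLengths_kronecker] at hl ⊢
  obtain ⟨m, hm, hl⟩ := hl
  have hr : ∀ n ∈ Finset.Icc 1 N, N + 1 - n ∈ Finset.Icc 1 N := by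
    intro n hn
    rw [Finset.mem_Icc] at hn ⊢
    omega
  have hc : ∀ n ∈ Finset.Icc 1 N, ((N + 1 - n : ℕ) : ℝ) = N + 1 - n := by
    intro n hn
    rw [Finset.mem_Icc] at hn
    rw [Nat.cast_sub (by omega)]
    push_cast
    ring
  refine ⟨N + 1 - m, hr m hm, ?_⟩
  convert hl using 1
  ext t
  refine and_congr_right fun _ => ⟨?_, ?_⟩
  · rintro ⟨n, hn, k, hk⟩
    refine ⟨N + 1 - n, hr n hn, k, ?_⟩
    rw [hc n hn, hk, hc m hm]
    ring
  · rintro ⟨n, hn, k, hk⟩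
    refine ⟨N + 1 - n, hr n hn, k, ?_⟩
    rw [hc n hn, hk, hc m hm]
    ring

theorem gapLengths_kronecker_neg (z : ℝ) (N : ℕ) :
    gapLengths (kronecker (-z)) N = gapLengths (kronecker z) N := by
  refine (gapLengths_kronecker_neg_subset z N).antisymm' ?_
  simpa using gapLengths_kronecker_neg_subset (-z) N

theorem pos_of_mem_gapLengths {x : ℕ → ℝ} {N : ℕ} {l : ℝ} (hl : l ∈ gapLengths x N) : 0 < l := by
  obtain ⟨m, -, h⟩ := hl
  exact h.1.1

theorem le_one_of_mem_gapLengths {x : ℕ → ℝ} {N : ℕ} {l : ℝ} (hl : l ∈ gapLengths x N) :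
    l ≤ 1 := by
  obtain ⟨m, hm, h⟩ := hl
  exact h.2 ⟨one_pos, m, hm, 1, by simp⟩

/-! ### Gaps from a pair of approximations of opposite sign -/

/-- Coordinates of an integer vector in a unimodular basis. -/
theorem exists_unimodular_coords {q r p p' : ℤ} (hdet : |q * p' - r * p| = 1) (d k : ℤ) :
    ∃ u v : ℤ, d = u * q + v * r ∧ k = u * p + v * p' := by
  have hsq : (q * p' - r * p) * (q * p' - r * p) = 1 := by
    rw [← abs_mul_abs_self, hdet]
    rfl
  refine ⟨(q * p' - r * p) * (d * p' - k * r), (q * p' - r * p) * (q * k - p * d), ?_, ?_⟩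
  · linear_combination (-d) * hsq
  · linear_combination (-k) * hsq

/-- Raising the index by `r` moves forward by `b`, lowering it by `q - r` moves forward by `b - a`;
from any index one of these moves stays in range. -/
theorem gap_le_sub_of_pos {z : ℝ} {q r : ℕ} {p p' : ℤ}
    (ha : (q : ℝ) * z - p < 0) (hb : 0 < (r : ℝ) * z - p') {N : ℕ} (hN : q ≤ N) (hrq : r ≤ q)
    {l : ℝ} (hl : l ∈ gapLengths (kronecker z) N) :
    l ≤ ((r : ℝ) * z - p') - (q * z - p) := by
  obtain ⟨m, hm, h⟩ := mem_gapLengths_kronecker.1 hl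
  rw [Finset.mem_Icc] at hm
  rcases le_or_gt m (q - r) with hmr | hmr
  · have hle : l ≤ (r : ℝ) * z - p' := by
      refine h.2 ⟨hb, m + r, Finset.mem_Icc.2 ⟨by omega, by omega⟩, -p', ?_⟩
      push_cast
      ring
    linarith
  · refine h.2 ⟨by linarith, m - (q - r), Finset.mem_Icc.2 ⟨by omega, by omega⟩, p - p', ?_⟩
    rw [Nat.cast_sub hmr.le, Nat.cast_sub hrq]
    push_cast
    ring

theorem gapLengths_eq_of_pos {z : ℝ} {q r : ℕ} {p p' : ℤ}
    (hdet : |(q : ℤ) * p' - r * p| = 1) (hr : 1 ≤ r) (hrq : r < q)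
    (ha : (q : ℝ) * z - p < 0) (hb : 0 < (r : ℝ) * z - p') :
    gapLengths (kronecker z) q =
      {(r : ℝ) * z - p', ((r : ℝ) * z - p') - (q * z - p)} := by
  set a := (q : ℝ) * z - p with ha_def
  set b := (r : ℝ) * z - p' with hb_def
  have coords : ∀ m ∈ Finset.Icc 1 q, ∀ t : ℝ, 0 < t →
      (∃ n ∈ Finset.Icc 1 q, ∃ k : ℤ, t = ((n : ℝ) - m) * z + k) →
      ∃ u v : ℤ, 1 ≤ v ∧ t = u * a + v * b ∧ u * q + v * r ≤ q - m := by
    rintro m hm t ht ⟨n, hn, k, hk⟩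
    rw [Finset.mem_Icc] at hm hn
    obtain ⟨u, v, hd, hk'⟩ := exists_unimodular_coords hdet ((n : ℤ) - m) (-k)
    have hdR : (n : ℝ) - m = u * q + v * r := by exact_mod_cast hd
    have hkR : -(k : ℝ) = u * p + v * p' := by exact_mod_cast hk'
    have htu : t = u * a + v * b := by
      rw [hk, ha_def, hb_def, hdR]
      linear_combination -hkR
    refine ⟨u, v, ?_, htu, by omega⟩
    -- If `v ≤ 0`, then `t > 0` forces `u < 0`, and the index would drop by at least `q`.
    by_contra hv
    have hv0 : v ≤ 0 := by omega
    have hvR : (v : ℝ) ≤ 0 := by exact_mod_cast hv0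
    have hu : u < 0 := by
      by_contra hu
      have huR : (0 : ℝ) ≤ u := by exact_mod_cast not_lt.1 hu
      nlinarith [mul_nonneg huR (neg_nonneg.2 ha.le), mul_nonneg (neg_nonneg.2 hvR) hb.le]
    have h1 : u * (q : ℤ) ≤ -1 * q := mul_le_mul_of_nonneg_right (by omega) (by omega)
    have h2 : v * (r : ℤ) ≤ 0 := mul_nonpos_of_nonpos_of_nonneg hv0 (by omega)
    omega
  have low : ∀ m ∈ Finset.Icc 1 (q - r),
      IsLeast {t : ℝ | 0 < t ∧ ∃ n ∈ Finset.Icc 1 q, ∃ k : ℤ, t = ((n : ℝ) - m) * z + k} b := by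
    intro m hm
    rw [Finset.mem_Icc] at hm
    refine ⟨⟨hb, m + r, Finset.mem_Icc.2 ⟨by omega, by omega⟩, -p', ?_⟩, ?_⟩
    · rw [hb_def]
      push_cast
      ring
    · rintro t ⟨ht, h⟩
      obtain ⟨u, v, hv, rfl, hd⟩ := coords m (Finset.mem_Icc.2 ⟨by omega, by omega⟩) t ht h
      have hvR : (1 : ℝ) ≤ v := by exact_mod_cast hv
      have hu : u ≤ 0 := by
        by_contra hu
        have h1 : 1 * (q : ℤ) ≤ u * q := mul_le_mul_of_nonneg_right (by omega) (by omega)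
        have h2 : 1 * (r : ℤ) ≤ v * r := mul_le_mul_of_nonneg_right hv (by omega)
        omega
      have huR : (u : ℝ) ≤ 0 := by exact_mod_cast hu
      nlinarith [mul_nonneg_of_nonpos_of_nonpos huR ha.le,
        mul_nonneg (sub_nonneg.2 hvR) hb.le]
  have high : ∀ m ∈ Finset.Icc 1 q, q - r < m →
      IsLeast {t : ℝ | 0 < t ∧ ∃ n ∈ Finset.Icc 1 q, ∃ k : ℤ, t = ((n : ℝ) - m) * z + k}
        (b - a) := by
    intro m hm hmr
    have hm' := Finset.mem_Icc.1 hm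
    refine ⟨⟨by linarith, m - (q - r), Finset.mem_Icc.2 ⟨by omega, by omega⟩, p - p', ?_⟩, ?_⟩
    · rw [Nat.cast_sub hmr.le, Nat.cast_sub hrq.le, ha_def, hb_def]
      push_cast
      ring
    · rintro t ⟨ht, h⟩
      obtain ⟨u, v, hv, rfl, hd⟩ := coords m hm t ht h
      have hvR : (1 : ℝ) ≤ v := by exact_mod_cast hv
      -- Here fewer than `r` indices remain above `m`, so `v ≥ 1` must be compensated by a negative
      -- `u`.
      have hu : u ≤ -1 := by
        by_contra hu
        have h1 : 0 ≤ u * (q : ℤ) := mul_nonneg (by omega) (by omega)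
        have h2 : 1 * (r : ℤ) ≤ v * r := mul_le_mul_of_nonneg_right hv (by omega)
        omega
      have huR : (u : ℝ) + 1 ≤ 0 := by exact_mod_cast (by omega : u + 1 ≤ 0)
      nlinarith [mul_nonneg_of_nonpos_of_nonpos huR ha.le,
        mul_nonneg (sub_nonneg.2 hvR) hb.le]
  ext l
  rw [mem_gapLengths_kronecker, Set.mem_insert_iff, Set.mem_singleton_iff]
  constructor
  · rintro ⟨m, hm, hl⟩
    have hm' := Finset.mem_Icc.1 hm
    rcases le_or_gt m (q - r) with hmr | hmr
    · exact Or.inl (hl.unique (low m (Finset.mem_Icc.2 ⟨hm'.1, hmr⟩)))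
    · exact Or.inr (hl.unique (high m hm hmr))
  · rintro (rfl | rfl)
    · exact ⟨1, Finset.mem_Icc.2 ⟨le_rfl, by omega⟩, low 1 (Finset.mem_Icc.2 ⟨le_rfl, by omega⟩)⟩
    · have hq : q ∈ Finset.Icc 1 q := Finset.mem_Icc.2 ⟨by omega, le_rfl⟩
      exact ⟨q, hq, high q hq (by omega)⟩

/-- Two integer approximations `q * z - p` and `r * z - p'` of opposite signs, with `r ≤ q`, bound
all gap lengths of at least `q` points. -/
theorem gap_le_add_abs {z : ℝ} {q r : ℕ} {p p' : ℤ}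
    (hs : ((q : ℝ) * z - p) * (r * z - p') < 0) {N : ℕ} (hN : q ≤ N) (hrq : r ≤ q)
    {l : ℝ} (hl : l ∈ gapLengths (kronecker z) N) :
    l ≤ |(q : ℝ) * z - p| + |(r : ℝ) * z - p'| := by
  rcases mul_neg_iff.1 hs with ⟨ha, hb⟩ | ⟨ha, hb⟩
  · rw [← gapLengths_kronecker_neg] at hl
    have := gap_le_sub_of_pos (z := -z) (q := q) (r := r) (p := -p) (p' := -p')
      (by push_cast; linarith) (by push_cast; linarith) hN hrq hl
    rw [abs_of_pos ha, abs_of_neg hb]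
    push_cast at this
    linarith
  · rw [abs_of_neg ha, abs_of_pos hb]
    linarith [gap_le_sub_of_pos ha hb hN hrq hl]

/-- If `(q, p)` and `(r, p')` form a unimodular basis and approximate `z` from opposite sides, then
the first `q` points of the Kronecker sequence have exactly two gap lengths. -/
theorem gapLengths_eq_pair {z : ℝ} {q r : ℕ} {p p' : ℤ}
    (hdet : |(q : ℤ) * p' - r * p| = 1) (hr : 1 ≤ r) (hrq : r < q)
    (hs : ((q : ℝ) * z - p) * (r * z - p') < 0) :
    gapLengths (kronecker z) q =
      {|(r : ℝ) * z - p'|, |(q : ℝ) * z - p| + |(r : ℝ) * z - p'|} := by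
  rcases mul_neg_iff.1 hs with ⟨ha, hb⟩ | ⟨ha, hb⟩
  · rw [← gapLengths_kronecker_neg, gapLengths_eq_of_pos (p := -p) (p' := -p') (by
      rw [← hdet, ← abs_neg]
      congr 1
      ring) hr hrq (by push_cast; linarith) (by push_cast; linarith), abs_of_pos ha, abs_of_neg hb]
    push_cast
    ring_nf
  · rw [gapLengths_eq_of_pos hdet hr hrq ha hb, abs_of_neg ha, abs_of_pos hb]
    congr 2
    ring

/-- In `q b - r a` the number `z` cancels and leaves the determinant up to sign; opposite signs of
`a`, `b` prevent cancellation between the two terms. -/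
theorem mul_abs_add_mul_abs_eq_one {z : ℝ} {q r : ℕ} {p p' : ℤ}
    (hdet : |(q : ℤ) * p' - r * p| = 1) (hs : ((q : ℝ) * z - p) * (r * z - p') < 0) :
    (q : ℝ) * |(r : ℝ) * z - p'| + r * |(q : ℝ) * z - p| = 1 := by
  have hdetR : |(q : ℝ) * p' - r * p| = 1 := by exact_mod_cast hdet
  have hq : (0 : ℝ) ≤ q := q.cast_nonneg
  have hr : (0 : ℝ) ≤ r := r.cast_nonneg
  rcases mul_neg_iff.1 hs with ⟨ha, hb⟩ | ⟨ha, hb⟩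
  · rw [← hdetR, abs_of_pos ha, abs_of_neg hb, abs_of_nonneg]
    · ring
    · nlinarith [mul_nonneg hq (neg_nonneg.2 hb.le), mul_nonneg hr ha.le]
  · rw [← hdetR, abs_of_neg ha, abs_of_pos hb, abs_of_nonpos]
    · ring
    · nlinarith [mul_nonneg hq hb.le, mul_nonneg hr (neg_nonneg.2 ha.le)]

/-! ### Convergents of an irrational number -/

theorem stream_of_irrational {z : ℝ} (hz : Irrational z) (n : ℕ) :
    ∃ s : IntFractPair ℝ, IntFractPair.stream z n = some s ∧ Irrational s.fr ∧
      0 < s.fr ∧ s.fr < 1 := by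
  have key : ∀ y : ℝ, Irrational y → Irrational (IntFractPair.of y).fr ∧
      0 < (IntFractPair.of y).fr ∧ (IntFractPair.of y).fr < 1 := by
    intro y hy
    have hf : Irrational (Int.fract y) := hy.sub_intCast ⌊y⌋
    exact ⟨hf, (Int.fract_nonneg y).lt_of_ne' hf.ne_zero, Int.fract_lt_one y⟩
  induction n with
  | zero => exact ⟨_, IntFractPair.stream_zero z, key z hz⟩
  | succ n ih =>
    obtain ⟨s, hs, hirr, -, -⟩ := ih
    exact ⟨_, IntFractPair.stream_succ_of_some hs hirr.ne_zero, key _ hirr.inv⟩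

theorem stream_step_of_irrational {z : ℝ} (hz : Irrational z) (n : ℕ) :
    ∃ s s' : IntFractPair ℝ, IntFractPair.stream z n = some s ∧
      IntFractPair.stream z (n + 1) = some s' ∧ 0 < s.fr ∧ 0 < s'.fr ∧ s'.fr < 1 ∧
      1 ≤ s'.b ∧ s.fr⁻¹ = s'.b + s'.fr ∧ (GenContFract.of z).s.get? n = some ⟨1, s'.b⟩ := by
  obtain ⟨s, hs, -, h0, -⟩ := stream_of_irrational hz n
  obtain ⟨s', hs', -, h0', h1'⟩ := stream_of_irrational hz (n + 1)
  have h := IntFractPair.stream_succ_of_some hs h0.ne'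
  rw [hs', Option.some_inj] at h
  refine ⟨s, s', hs, hs', h0, h0', h1', IntFractPair.one_le_succ_nth_stream_b hs', ?_,
    get?_of_eq_some_of_succ_get?_intFractPair_stream hs'⟩
  rw [h]
  exact (Int.floor_add_fract _).symm

theorem partDens_get?_of_s {z : ℝ} {n : ℕ} {b : ℝ} (h : (GenContFract.of z).s.get? n = some ⟨1, b⟩) :
    (GenContFract.of z).partDens.get? n = some b :=
  partDen_eq_s_b h

theorem convDen_zero (z : ℝ) : convDen z 0 = 1 := by
  have h := convDen_cast z 0
  rw [zeroth_den_eq_one] at h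
  exact_mod_cast h

/-- The denominator of the first convergent is the first partial quotient. -/
theorem convDen_one_eq {z c : ℝ} (h : (GenContFract.of z).s.get? 0 = some ⟨1, c⟩) :
    (convDen z 1 : ℝ) = c := by
  rw [convDen_cast, first_den_eq h]

theorem convDen_add_two_eq {z c : ℝ} {i : ℕ} (h : (GenContFract.of z).s.get? (i + 1) = some ⟨1, c⟩) :
    (convDen z (i + 2) : ℝ) = c * convDen z (i + 1) + convDen z i := by
  rw [convDen_cast, convDen_cast, convDen_cast, dens_recurrence h rfl rfl, one_mul]

/-- Consecutive convergents of an irrational number form a unimodular basis and approximate it from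
opposite sides, the later one better. -/
theorem exists_convergent_nums {z : ℝ} (hz : Irrational z) (i : ℕ) :
    1 ≤ convDen z i ∧ i + 1 ≤ convDen z (i + 1) ∧
    (convDen z i < convDen z (i + 1) ∨ convDen z i = 1 ∧ convDen z (i + 1) = 1) ∧
    ∃ p p' : ℤ, |(convDen z (i + 1) : ℤ) * p' - convDen z i * p| = 1 ∧
      ((convDen z (i + 1) : ℝ) * z - p) * (convDen z i * z - p') < 0 ∧
      |(convDen z (i + 1) : ℝ) * z - p| < |(convDen z i : ℝ) * z - p'| := by
  -- The induction carries an exact relation: each error is the previous one times minus a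
  -- fractional part in `(0, 1)`. Alternation and decrease follow.
  suffices H : 1 ≤ convDen z i ∧ i + 1 ≤ convDen z (i + 1) ∧
      (convDen z i < convDen z (i + 1) ∨ convDen z i = 1 ∧ convDen z (i + 1) = 1) ∧
      ∃ s : IntFractPair ℝ, IntFractPair.stream z (i + 1) = some s ∧
      ∃ p p' : ℤ, |(convDen z (i + 1) : ℤ) * p' - convDen z i * p| = 1 ∧
        (convDen z i : ℝ) * z - p' ≠ 0 ∧
        (convDen z (i + 1) : ℝ) * z - p = -(convDen z i * z - p') * s.fr by
    obtain ⟨h1, h2, h3, s, hs, p, p', hdet, hne, heq⟩ := H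
    obtain ⟨s', hs', -, h0, hlt⟩ := stream_of_irrational hz (i + 1)
    obtain rfl : s = s' := by rwa [hs, Option.some_inj] at hs'
    refine ⟨h1, h2, h3, p, p', hdet, ?_, ?_⟩
    · rw [heq]
      nlinarith [mul_pos (sq_pos_of_ne_zero hne) h0]
    · rw [heq, abs_mul, abs_neg, abs_of_pos h0]
      exact mul_lt_of_lt_one_right (abs_pos.2 hne) hlt
  induction i with
  | zero =>
    obtain ⟨s, s', hs, hs', h0, h0', -, hb, hinv, hget⟩ := stream_step_of_irrational hz 0
    have hq : (convDen z 1 : ℤ) = s'.b := by exact_mod_cast convDen_one_eq hget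
    rw [IntFractPair.stream_zero, Option.some_inj] at hs
    have hfr : z - ⌊z⌋ = s.fr := by rw [← hs]; rfl
    rw [convDen_zero, zero_add]
    refine ⟨le_rfl, by omega, by omega, s', hs', s'.b * ⌊z⌋ + 1, ⌊z⌋, ?_, ?_, ?_⟩
    · rw [hq, ← abs_neg]
      simp
    · rw [Nat.cast_one, one_mul, hfr]
      exact h0.ne'
    · have hqR : (convDen z 1 : ℝ) = s'.b := by exact_mod_cast hq
      rw [hqR, Nat.cast_one, one_mul, hfr]
      push_cast
      have h1 : s.fr * (s'.b + s'.fr) = 1 := by rw [← hinv, mul_inv_cancel₀ h0.ne']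
      linear_combination h1 + (s'.b : ℝ) * hfr
  | succ i ih =>
    obtain ⟨h1, h2, h3, s₀, hs₀, p, p', hdet, hne, heq⟩ := ih
    obtain ⟨s, s', hs, hs', h0, h0', -, hb, hinv, hget⟩ := stream_step_of_irrational hz (i + 1)
    obtain rfl : s₀ = s := by rwa [hs₀, Option.some_inj] at hs
    have hqR := convDen_add_two_eq hget
    have hq : (convDen z (i + 2) : ℤ) = s'.b * convDen z (i + 1) + convDen z i := by
      exact_mod_cast hqR
    have hle : 1 * (convDen z (i + 1) : ℤ) ≤ s'.b * convDen z (i + 1) :=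
      mul_le_mul_of_nonneg_right hb (by omega)
    refine ⟨by omega, by rw [show i + 1 + 1 = i + 2 from rfl]; omega,
      Or.inl (by rw [show i + 1 + 1 = i + 2 from rfl]; omega), s', hs', s'.b * p + p', p, ?_, ?_, ?_⟩
    · rw [show i + 1 + 1 = i + 2 from rfl, hq, ← hdet, ← abs_neg]
      congr 1
      ring
    · rw [heq]
      exact mul_ne_zero (neg_ne_zero.2 hne) h0.ne'
    · rw [show i + 1 + 1 = i + 2 from rfl, hqR]
      push_cast
      have h1 : s₀.fr * (s'.b + s'.fr) = 1 := by rw [← hinv, mul_inv_cancel₀ h0.ne']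
      linear_combination ((s'.b : ℝ) + s'.fr) * heq - (convDen z i * z - p') * h1

/-! ### Asymptotics and the main theorem -/

theorem gap_mul_le_of_bounded {z : ℝ} (hz : Irrational z) (hK : HasBoundedPartialQuotients z) :
    ∃ C : ℝ, ∀ (N : ℕ) (l : ℝ), 1 ≤ N → l ∈ gapLengths (kronecker z) N → N * l ≤ C := by
  obtain ⟨K, hK⟩ := hK
  have hstep : ∀ i, (convDen z (i + 1) : ℝ) ≤ (K + 1) * convDen z i := by
    intro i
    obtain ⟨-, s, -, -, -, -, -, -, -, hget⟩ := stream_step_of_irrational hz i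
    have hsK := hK i s.b (partDens_get?_of_s hget)
    cases i with
    | zero =>
      rw [zero_add, convDen_one_eq hget, convDen_zero]
      push_cast
      linarith
    | succ i =>
      obtain ⟨-, -, h, -⟩ := exists_convergent_nums hz i
      have hle : (convDen z i : ℝ) ≤ convDen z (i + 1) := by exact_mod_cast (by omega)
      rw [convDen_add_two_eq hget]
      nlinarith [mul_le_mul_of_nonneg_right hsK (Nat.cast_nonneg (α := ℝ) (convDen z (i + 1)))]
  refine ⟨(K + 1) * 2, fun N l hN hl => ?_⟩
  have hl0 := pos_of_mem_gapLengths hl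
  have hl1 := le_one_of_mem_gapLengths hl
  -- The least such `i` locates `N` between consecutive denominators; for `i = 0` the trivial bound
  -- `l ≤ 1` suffices.
  have hex : ∃ i, N < convDen z (i + 1) :=
    ⟨N, (exists_convergent_nums hz N).2.1⟩
  have hlt := Nat.find_spec hex
  have hmin : ∀ j < Nat.find hex, convDen z (j + 1) ≤ N := fun j hj =>
    not_lt.1 (Nat.find_min hex hj)
  generalize Nat.find hex = i at hlt hmin
  have hltR : (N : ℝ) ≤ convDen z (i + 1) := by exact_mod_cast hlt.le
  have hNq : (N : ℝ) ≤ (K + 1) * convDen z i := hltR.trans (hstep i)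
  have hN0 : (1 : ℝ) ≤ N := by exact_mod_cast hN
  have hq1 : (1 : ℝ) ≤ convDen z i := by exact_mod_cast (exists_convergent_nums hz i).1
  have hK1 : 0 ≤ K + 1 := by
    by_contra h
    nlinarith
  have hql : convDen z i * l ≤ 2 := by
    cases i with
    | zero =>
      rw [convDen_zero]
      push_cast
      linarith
    | succ i =>
      obtain ⟨-, -, h, p, p', hdet, hs, habs⟩ := exists_convergent_nums hz i
      have hle := gap_le_add_abs hs (hmin i (Nat.lt_succ_self i)) (by omega) hl
      have hone := mul_abs_add_mul_abs_eq_one hdet hs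
      have hr := mul_nonneg (Nat.cast_nonneg (α := ℝ) (convDen z i))
        (abs_nonneg ((convDen z (i + 1) : ℝ) * z - p))
      have h2 : l ≤ 2 * |(convDen z i : ℝ) * z - p'| := by linarith
      nlinarith [mul_le_mul_of_nonneg_left h2 (Nat.cast_nonneg (α := ℝ) (convDen z (i + 1)))]
  nlinarith [mul_le_mul_of_nonneg_right hNq hl0.le, mul_le_mul_of_nonneg_left hql hK1]

theorem isSmallGap_of_mul_le {α C : ℝ} (hα : α < 1) {N : ℕ → ℕ} {l : ℕ → ℝ}
    (hN : Tendsto N atTop atTop) (h0 : ∀ᶠ i in atTop, 0 ≤ l i)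
    (hC : ∀ᶠ i in atTop, N i * l i ≤ C) : IsSmallGap α N l := by
  have hlim : Tendsto (fun i => C * (N i : ℝ) ^ (-(1 - α))) atTop (𝓝 0) := by
    have h := ((tendsto_rpow_neg_atTop (sub_pos.2 hα)).comp
      (tendsto_natCast_atTop_atTop (R := ℝ))).comp hN
    simpa using h.const_mul C
  refine squeeze_zero' ?_ ?_ hlim
  · filter_upwards [h0] with i hi
    positivity
  · filter_upwards [hC, hN.eventually_ge_atTop 1] with i hi hi1
    have hpos : (0 : ℝ) < N i := by exact_mod_cast hi1
    have : (N i : ℝ) ^ α = N i * (N i : ℝ) ^ (-(1 - α)) := by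
      rw [show α = 1 + -(1 - α) by ring, Real.rpow_add hpos, Real.rpow_one]
      ring_nf
    rw [this, mul_right_comm]
    exact mul_le_mul_of_nonneg_right hi (Real.rpow_nonneg hpos.le _)

theorem mainTheorem7 (z : ℝ) (hz : Irrational z) :
    (HasBoundedPartialQuotients z → ∀ α : ℝ, α < 1 →
      (∀ (N : ℕ → ℕ) (s : ℕ) (L : ℕ → Fin s → ℝ), IsGapSystem (kronecker z) N s L →
        ∀ j : Fin s, IsSmallGap α N (fun i => L i j)) ∧
      (∀ l : ℕ → ℝ, (∀ n : ℕ, 1 ≤ n → l n ∈ gapLengths (kronecker z) n) →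
        IsSmallGap α (fun n => n) l)) ∧
    (∀ i₀ : ℕ, 2 ≤ convDen z i₀ →
      ∃ L : ℕ → Fin 2 → ℝ,
        IsGapSystem (kronecker z) (fun i => convDen z (i₀ + i)) 2 L ∧
        IsIntermediateGap 1 (fun i => convDen z (i₀ + i)) (fun i => L i 1)) := by
  refine ⟨fun hK α hα => ?_, fun i₀ hi₀ => ?_⟩
  · obtain ⟨C, hC⟩ := gap_mul_le_of_bounded hz hK
    refine ⟨fun N s L hL j => ?_, fun l hl => ?_⟩
    · have hmem : ∀ i, L i j ∈ gapLengths (kronecker z) (N i) := fun i =>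
        hL.range_length i ▸ Set.mem_range_self j
      have hN := hL.strictMono_index.tendsto_atTop
      refine isSmallGap_of_mul_le hα hN (.of_forall fun i => (pos_of_mem_gapLengths (hmem i)).le)
        ?_ (C := C)
      filter_upwards [hN.eventually_ge_atTop 1] with i hi using hC _ _ hi (hmem i)
    · refine isSmallGap_of_mul_le hα tendsto_id ?_ ?_ (C := C)
      · filter_upwards [eventually_ge_atTop 1] with n hn using (pos_of_mem_gapLengths (hl n hn)).le
      · filter_upwards [eventually_ge_atTop 1] with n hn using hC _ _ hn (hl n hn)
  · obtain ⟨k, rfl⟩ : ∃ k, i₀ = k + 1 := by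
      refine Nat.exists_eq_succ_of_ne_zero fun h => ?_
      rw [h, convDen_zero] at hi₀
      omega
    have hstrict : StrictMono fun i => convDen z (k + 1 + i) := by
      refine strictMono_nat_of_lt_succ fun i => ?_
      have h1 := (exists_convergent_nums hz (k + i)).2.1
      have h2 := (exists_convergent_nums hz (k + 1 + i)).2
      have h3 := h2.1
      rcases h2.2.1 with h | ⟨-, h⟩
      · exact h
      · omega
    have hdata : ∀ i, ∃ A B : ℝ, 0 < A ∧ 0 < B ∧
        gapLengths (kronecker z) (convDen z (k + 1 + i)) = {B, A + B} ∧
        1 ≤ convDen z (k + 1 + i) * (A + B) ∧ convDen z (k + 1 + i) * (A + B) ≤ 2 := by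
      intro i
      rw [show k + 1 + i = k + i + 1 by ring]
      have hge : convDen z (k + 1) ≤ convDen z (k + i + 1) := by
        have h := hstrict.monotone (Nat.zero_le i)
        simp only [add_zero] at h
        rwa [show k + 1 + i = k + i + 1 by ring] at h
      obtain ⟨h1, -, h, p, p', hdet, hs, habs⟩ := exists_convergent_nums hz (k + i)
      -- Equality of consecutive denominators occurs only at the value 1, excluded by `hi₀` and
      -- monotonicity.
      have hrq : convDen z (k + i) < convDen z (k + i + 1) := by omega
      have hone := mul_abs_add_mul_abs_eq_one hdet hs
      have hrqR : (convDen z (k + i) : ℝ) ≤ convDen z (k + i + 1) := by exact_mod_cast hrq.le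
      have hA := abs_pos.2 (left_ne_zero_of_mul hs.ne)
      have hB := abs_pos.2 (right_ne_zero_of_mul hs.ne)
      refine ⟨_, _, hA, hB, gapLengths_eq_pair hdet h1 hrq hs, ?_, ?_⟩
      · nlinarith [mul_le_mul_of_nonneg_right hrqR hA.le]
      · have hr := mul_nonneg (Nat.cast_nonneg (α := ℝ) (convDen z (k + i))) hA.le
        nlinarith [mul_le_mul_of_nonneg_left habs.le
          (Nat.cast_nonneg (α := ℝ) (convDen z (k + i + 1)))]
    choose A B hA hB hgap hlow hupp using hdata
    refine ⟨fun i => ![B i, A i + B i], ⟨hstrict, fun i => ?_, fun i => ?_⟩,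
      1, 2, one_pos, two_pos, fun i => ?_⟩
    · refine Fin.strictMono_iff_lt_succ.2 fun j => ?_
      fin_cases j
      simpa using hA i
    · rw [hgap i]
      simp [Set.pair_comm]
    · have hpos : (0 : ℝ) < convDen z (k + 1 + i) := by
        have h := hstrict.monotone (Nat.zero_le i)
        simp only [add_zero] at h
        exact_mod_cast (by omega : 0 < convDen z (k + 1 + i))
      simp only [Real.rpow_one, Matrix.cons_val_one, Matrix.cons_val_fin_one]
      rw [div_le_iff₀ hpos, le_div_iff₀ hpos, mul_comm (A i + B i)]
      exact ⟨hlow i, hupp i⟩
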